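/- Let $S$ be a connected closed oriented surface and let $D$ be a diagram in $S$ of an oriented link $L\subset S\times[0,1]$, that is, a finite 4-valent graph embedded in $S$ (possibly with closed components without vertices) with over/under information at its vertices (the crossings) and an orientation of the link components. Suppose $D$ carries a source-sink structure: an orientation of the edges such that at each crossing two opposite edges are incoming and the other two are outgoing. Let $\mathfrak H$ be the free abelian group on the set $[S^1;S]$ of free homotopy classes of oriented loops, modulo $\bigcirc=0$ (contractible loops) and $[\gamma]=[-\gamma]$. Let $V$ be the $\mathbb Z_2$-space with basis $v_\pm$, $\deg v_\pm=\pm1$, with $m(v_+\otimes v_+)=v_+$, $m(v_+\otimes v_-)=m(v_-\otimes v_+)=v_-$, $m(v_-\otimes v_-)=0$ and $\Delta(v_+)=v_+\otimes v_-+v_-\otimes v_+$, $\Delta(v_-)=v_-\otimes v_-$. A state $s$ chooses the $0$- or $1$-resolution at each crossing (the $0$-resolution joins the two regions swept when the overcrossing strand is turned counterclockwise). Its resolution $D_s$ is a set of disjoint circles $C_1,\dots,C_{\gamma(s)}$, oriented by the source-sink structure; put $V(s)=V^{\otimes\gamma(s)}$ and $[[D]]=\bigoplus_s V(s)$, and let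 $d$ be the Khovanov differential: the sum over all changes of one resolution from $0$ to $1$ of the maps given by $m$ on two merging circles, by $\Delta$ on a splitting circle, and by the identity on the other circles. For $x=x_1\otimes\cdots\otimes x_{\gamma(s)}\in V(s)$ with $x_k=v_\pm$ let $\beta(s)$ be the number of $1$s in $s$, let $n_\pm$ be the numbers of positive and negative crossings, and define the homological grading $\beta(s)-n_-$, the quantum grading $\sum_k\deg x_k+\beta(s)+n_+-2n_-$ and the homotopical grading $\sum_k\deg(x_k)[C_k]\in\mathfrak H$. Let $d_h$ be the part of $d$ that preserves the homotopical grading, and let $Kh_h(D)_{i,j,\mathfrak h}$ be the homology of $([[D]],d_h)$ in homological degree $i$, quantum degree $j$ and homotopical degree $\mathfrak h$. This is the homotopical Khovanov homology $Kh_h(L)_{i,j,\mathfrak h}$ of $L$, computed from the diagram $D$. Let $-L$ be $L$ with the orientations of all components reversed (diagram: $D$ with reversed link orientation), let $\bar L$ be the mirror image of $L$ under $(x,t)\mapsto(x,1-t)$ (diagram: $D$ with over- and undercrossings exchanged, with the same link orientation and source-sink structure), and let $\check L$ be $L$ with the opposite source-sink structure (diagram: $D$ with the orientations of all edges in the source-sink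 structure reversed). Then for all $i,j\in\mathbb Z$ and $\mathfrak h\in\mathfrak H$ there are isomorphisms of $\mathbb Z_2$-vector spaces, where all homologies are computed from the indicated diagrams, $$Kh_h(-L)_{i,j,\mathfrak h}\cong Kh_h(L)_{i,j,\mathfrak h},\qquad Kh_h(\bar L)_{i,j,\mathfrak h}\cong Kh_h(L)_{-i,-j,-\mathfrak h},\qquad Kh_h(\check L)_{i,j,\mathfrak h}\cong Kh_h(L)_{i,j,\mathfrak h}.$$ Moreover, $Kh_h(D)_{i,j,\mathfrak h}$ is, up to isomorphism, the same for any two source-sink structures on $D$: it does not depend on the choice of the source-sink structure. (By the first isomorphism it does not detect invertibility of knots.) -/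

import Mathlib

open scoped Manifold ContDiff unitInterval

noncomputable section

namespace HomotopicalKhovanov

/-! ### Oriented surfaces and free homotopy classes of loops -/

/-- A smooth surface, modelled on the real plane `ℂ` with its standard orientation `(1, i)`,
all of whose transition maps preserve the orientation. -/
class OrientedSurface (S : Type*) [TopologicalSpace S] [ChartedSpace ℂ S] : Prop
    extends IsManifold 𝓘(ℝ, ℂ) ∞ S where
  det_pos : ∀ e ∈ atlas ℂ S, ∀ e' ∈ atlas ℂ S, ∀ z ∈ (e.symm.trans e').source,
    0 < (fderiv ℝ (e.symm.trans e') z).det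

/-- A smooth chart that is compatible with the orientation given by the atlas. -/
def IsOrientedChart {S : Type*} [TopologicalSpace S] [ChartedSpace ℂ S]
    (φ : OpenPartialHomeomorph S ℂ) : Prop :=
  φ ∈ IsManifold.maximalAtlas 𝓘(ℝ, ℂ) ∞ S ∧
    ∀ e ∈ atlas ℂ S, ∀ z ∈ (e.symm.trans φ).source, 0 < (fderiv ℝ (e.symm.trans φ) z).det

/-- Free homotopy of loops. -/
def loopSetoid (S : Type*) [TopologicalSpace S] : Setoid C(Circle, S) where
  r := ContinuousMap.Homotopic
  iseqv := ContinuousMap.Homotopic.equivalence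

/-- The set `[S¹; S]` of free homotopy classes of oriented loops. -/
def LoopClass (S : Type*) [TopologicalSpace S] : Type _ := Quotient (loopSetoid S)

/-- The free homotopy class of a loop. -/
def LoopClass.mk {S : Type*} [TopologicalSpace S] (γ : C(Circle, S)) : LoopClass S :=
  Quotient.mk (loopSetoid S) γ

/-- The loop `-γ`, that is, `γ` with the opposite orientation. -/
def revLoop {S : Type*} [TopologicalSpace S] (γ : C(Circle, S)) : C(Circle, S) :=
  γ.comp ⟨fun z => z⁻¹, continuous_inv⟩

/-- The subgroup of relations `○ = 0` and `[γ] = [-γ]`. -/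
def loopRelations (S : Type*) [TopologicalSpace S] :
    AddSubgroup (FreeAbelianGroup (LoopClass S)) :=
  AddSubgroup.closure
    ({a | ∃ p : S, a = FreeAbelianGroup.of (LoopClass.mk (ContinuousMap.const Circle p))} ∪
     {a | ∃ γ : C(Circle, S), a = FreeAbelianGroup.of (LoopClass.mk γ) -
        FreeAbelianGroup.of (LoopClass.mk (revLoop γ))})

/-- The group `𝔥` of homotopical gradings: the free abelian group on the free homotopy classes of
oriented loops modulo `○ = 0` and `[γ] = [-γ]`. -/
abbrev HGroup (S : Type*) [TopologicalSpace S] : Type _ :=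
  FreeAbelianGroup (LoopClass S) ⧸ loopRelations S

/-- The element `[γ]` of `𝔥`. -/
def HGroup.cls {S : Type*} [TopologicalSpace S] (γ : C(Circle, S)) : HGroup S :=
  QuotientAddGroup.mk (FreeAbelianGroup.of (LoopClass.mk γ))

/-! ### Link diagrams -/

/-- A link diagram in the surface `S`: a finite `4`-valent graph embedded in `S`, possibly with
closed components without vertices, together with over/under information at the vertices
(the crossings).

Each crossing `c` is the centre of a closed disc, the preimage of the closed unit disc under an
oriented chart `chart c`, in which the diagram consists of the two strands
`[-1, 1]` and `[-i, i]`; the four half-edges at `c` meet the boundary of the disc in the points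
`i ^ k`, `k = 0, 1, 2, 3` (counterclockwise order). These half-edges are called the darts at `c`.
Outside the discs the diagram consists of the (truncated) edges `arc e`, which join two darts, and
of the closed components `loop l` without crossings. The strand `[-1, 1]` is the overcrossing one
if `realOver c` is `true`; otherwise `[-i, i]` is. -/
structure LinkDiagram (S : Type*) [TopologicalSpace S] [ChartedSpace ℂ S] where
  /-- the number of crossings -/
  n : ℕ
  /-- the number of edges that join crossings -/
  numArcs : ℕ
  /-- the number of closed components without crossings -/
  numLoops : ℕ
  chart : Fin n → OpenPartialHomeomorph S ℂ
  chart_oriented : ∀ c, IsOrientedChart (chart c)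
  ball_subset : ∀ c, Metric.closedBall (0 : ℂ) 1 ⊆ (chart c).target
  discs_disjoint : ∀ c c', c ≠ c' →
    Disjoint ((chart c).symm '' Metric.closedBall (0 : ℂ) 1)
      ((chart c').symm '' Metric.closedBall (0 : ℂ) 1)
  realOver : Fin n → Bool
  arc : Fin numArcs → C(I, S)
  loop : Fin numLoops → C(I, S)
  /-- the dart at the start (`false`) and at the end (`true`) of an edge -/
  attach : Fin numArcs × Bool ≃ Fin n × Fin 4
  arc_zero : ∀ e, arc e 0 = (chart (attach (e, false)).1).symm
    (Complex.I ^ ((attach (e, false)).2 : ℕ))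
  arc_one : ∀ e, arc e 1 = (chart (attach (e, true)).1).symm
    (Complex.I ^ ((attach (e, true)).2 : ℕ))
  arc_injective : ∀ e e' t t', arc e t = arc e' t' → e = e' ∧ t = t'
  arc_notMem_disc : ∀ e c t, t ≠ 0 → t ≠ 1 →
    arc e t ∉ (chart c).symm '' Metric.closedBall (0 : ℂ) 1
  loop_closed : ∀ l, loop l 0 = loop l 1
  loop_injective : ∀ l l' t t', t ≠ 1 → t' ≠ 1 → loop l t = loop l' t' → l = l' ∧ t = t'
  loop_notMem_disc : ∀ l c t, loop l t ∉ (chart c).symm '' Metric.closedBall (0 : ℂ) 1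
  arc_ne_loop : ∀ e l t t', arc e t ≠ loop l t'

namespace LinkDiagram

variable {S : Type*} [TopologicalSpace S] [ChartedSpace ℂ S] (D : LinkDiagram S)

/-- The edges of the diagram: those that join crossings, and the closed ones. -/
abbrev Edge : Type := Fin D.numArcs ⊕ Fin D.numLoops

/-- The (truncated) edge as a path in `S`. -/
def edge : D.Edge → C(I, S) := Sum.elim D.arc D.loop

/-- The closed disc around the crossing `c`. -/
def disc (c : Fin D.n) : Set S := (D.chart c).symm '' Metric.closedBall (0 : ℂ) 1

/-- The dart `k` at the crossing `c` belongs to the overcrossing strand. -/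
def IsOver (c : Fin D.n) (k : Fin 4) : Prop := Even (k : ℕ) ↔ D.realOver c = true

/-- An orientation of all edges; `true` means the orientation given by the parametrization. -/
abbrev EdgeOrientation : Type := D.Edge → Bool

variable {D} in
/-- The dart `k` at the crossing `c` is oriented away from `c`. -/
def EdgeOrientation.Outgoing (o : D.EdgeOrientation) (c : Fin D.n) (k : Fin 4) : Prop :=
  o (Sum.inl (D.attach.symm (c, k)).1) ≠ (D.attach.symm (c, k)).2

/-- An orientation of the link: an orientation of all edges such that the two strands
at each crossing pass straight through it. -/
structure LinkOrientation where
  dir : D.EdgeOrientation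
  straight : ∀ c k, dir.Outgoing c (k + 2) ↔ ¬ dir.Outgoing c k

/-- A source-sink structure: an orientation of all edges such that at each crossing two opposite
darts are incoming and the two other darts are outgoing. -/
structure SourceSink where
  dir : D.EdgeOrientation
  opposite : ∀ c k, dir.Outgoing c (k + 2) ↔ dir.Outgoing c k
  adjacent : ∀ c k, dir.Outgoing c (k + 1) ↔ ¬ dir.Outgoing c k

theorem outgoing_reverse (o : D.EdgeOrientation) (c : Fin D.n) (k : Fin 4) :
    EdgeOrientation.Outgoing (D := D) (fun e => !(o e)) c k ↔ ¬ o.Outgoing c k := by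
  simp only [EdgeOrientation.Outgoing]
  cases o (Sum.inl (D.attach.symm (c, k)).1) <;> cases (D.attach.symm (c, k)).2 <;> simp

variable {D}

/-- The opposite orientation of all components of the link. -/
def LinkOrientation.reverse (o : D.LinkOrientation) : D.LinkOrientation where
  dir := fun e => !(o.dir e)
  straight c k := by
    rw [outgoing_reverse, outgoing_reverse, o.straight]

/-- The opposite source-sink structure. -/
def SourceSink.reverse (τ : D.SourceSink) : D.SourceSink where
  dir := fun e => !(τ.dir e)
  opposite c k := by
    rw [outgoing_reverse, outgoing_reverse, τ.opposite]
  adjacent c k := by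
    rw [outgoing_reverse, outgoing_reverse, τ.adjacent]

variable (D)

/-- The mirror image, under the reflection `(x, t) ↦ (x, 1 - t)` of `S × [0, 1]`:
over- and undercrossings are exchanged. -/
def mirror : LinkDiagram S := { D with realOver := fun c => !(D.realOver c) }

variable {D}

/-- The orientation of the mirror image. -/
def LinkOrientation.mirror (o : D.LinkOrientation) : D.mirror.LinkOrientation where
  dir := o.dir
  straight := o.straight

/-- The source-sink structure of the mirror image. -/
def SourceSink.mirror (τ : D.SourceSink) : D.mirror.SourceSink where
  dir := τ.dir
  opposite := τ.opposite
  adjacent := τ.adjacent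

/-- The crossing `c` is positive: turning counterclockwise by a right angle takes the direction of
the overcrossing strand to that of the undercrossing one. -/
def LinkOrientation.Positive (o : D.LinkOrientation) (c : Fin D.n) : Prop :=
  ∃ k : Fin 4, D.IsOver c k ∧ o.dir.Outgoing c k ∧ o.dir.Outgoing c (k + 1)

/-- The number `n₊` of positive crossings. -/
def LinkOrientation.nPos (o : D.LinkOrientation) : ℕ := {c | o.Positive c}.ncard

/-- The number `n₋` of negative crossings. -/
def LinkOrientation.nNeg (o : D.LinkOrientation) : ℕ := {c | ¬ o.Positive c}.ncard

/-! ### States and circles -/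

variable (D)

/-- A state chooses the resolution `0` (`false`) or `1` (`true`) at each crossing. -/
abbrev State : Type := Fin D.n → Bool

/-- The arc in the disc around `c` that joins the darts `k` and `k + 1`. -/
def smoothingArc (c : Fin D.n) (k : Fin 4) : Set S :=
  (D.chart c).symm '' segment ℝ (Complex.I ^ (k : ℕ)) (Complex.I ^ ((k : ℕ) + 1))

/-- The resolution `D_s`. The `0`-resolution at a crossing joins each undercrossing dart with the
overcrossing dart that follows it counterclockwise (so it merges the two regions that are swept
when the overcrossing strand is turned counterclockwise), and the `1`-resolution joins each
overcrossing dart with the undercrossing dart that follows it counterclockwise. -/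
def resolution (s : D.State) : Set S :=
  (⋃ e : D.Edge, Set.range (D.edge e)) ∪
    ⋃ q : {q : Fin D.n × Fin 4 // D.IsOver q.1 q.2 ↔ s q.1 = true}, D.smoothingArc q.1.1 q.1.2

/-- The set of the circles of `D_s`, that is, of its connected components. -/
def circles (s : D.State) : Set (Set S) :=
  (fun p => connectedComponentIn (D.resolution s) p) '' D.resolution s

theorem isPreconnected_smoothingArc (c : Fin D.n) (k : Fin 4) :
    IsPreconnected (D.smoothingArc c k) := by
  refine (convex_segment _ _).isPreconnected.image _ ((D.chart c).continuousOn_symm.mono ?_)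
  refine subset_trans ?_ (D.ball_subset c)
  exact (convex_closedBall (0 : ℂ) 1).segment_subset (by simp) (by simp)

theorem finite_components {X ι : Type*} [TopologicalSpace X] [Finite ι] (P : ι → Set X)
    (hP : ∀ a, IsPreconnected (P a)) {Y : Set X} (hY : Y = ⋃ a, P a) :
    ((fun p => connectedComponentIn Y p) '' Y).Finite := by
  classical
  refine (Set.finite_range fun a : ι =>
    if h : (P a).Nonempty then connectedComponentIn Y h.some else ∅).subset ?_
  rintro _ ⟨p, hp, rfl⟩
  have hp' := hp
  rw [hY] at hp'
  obtain ⟨a, ha⟩ := Set.mem_iUnion.1 hp'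
  have hne : (P a).Nonempty := ⟨p, ha⟩
  refine ⟨a, ?_⟩
  have hsub : P a ⊆ Y := by
    rw [hY]
    exact Set.subset_iUnion P a
  simp only [hne, dif_pos]
  exact (connectedComponentIn_eq
    ((hP a).subset_connectedComponentIn hne.some_mem hsub ha))

theorem finite_circles (s : D.State) : (D.circles s).Finite := by
  refine finite_components
    (Sum.elim (fun e : D.Edge => Set.range (D.edge e))
      (fun q : {q : Fin D.n × Fin 4 // D.IsOver q.1 q.2 ↔ s q.1 = true} =>
        D.smoothingArc q.1.1 q.1.2)) ?_ ?_
  · rintro (e | q)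
    · exact isPreconnected_range (D.edge e).continuous
    · exact D.isPreconnected_smoothingArc _ _
  · rw [Set.iUnion_sum]
    rfl

instance (s : D.State) : Finite (D.circles s) := D.finite_circles s

instance (s : D.State) : Fintype (D.circles s) := Fintype.ofFinite _

variable {D}

/-- The loop `f` parametrizes the closed curve `C` in the direction given by the source-sink
structure `τ` on the edges that `C` contains. (In a crossing disc, each smoothing arc joins an
incoming and an outgoing dart, so every circle of a resolution inherits a direction from `τ`.) -/
def SourceSink.Parametrizes (τ : D.SourceSink) (C : Set S) (f : C(Circle, S)) : Prop :=
  Function.Injective f ∧ Set.range f = C ∧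
    ∀ e : D.Edge, Set.range (D.edge e) ⊆ C →
      ∃ θ : I → ℝ, Continuous θ ∧ (if τ.dir e then StrictMono θ else StrictAnti θ) ∧
        ∀ t, f (Circle.exp (θ t)) = D.edge e t

open Classical in
/-- The element `[C]` of `𝔥` for a circle `C` of a resolution, oriented by the source-sink
structure `τ`. -/
def SourceSink.circleClass (τ : D.SourceSink) (C : Set S) : HGroup S :=
  if h : ∃ f, τ.Parametrizes C f then HGroup.cls h.choose else 0

/-! ### The complex -/

variable (D)

/-- A state `s` with a basis vector `v₊` or `v₋` of `V` for each circle of `D_s`;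
here `v₊` and `v₋` are encoded by their degrees `1` and `-1`. These are the basis vectors
`x₁ ⊗ ⋯ ⊗ x_γ(s)` of `V(s) = V^{⊗ γ(s)}`, for all states `s`. -/
abbrev EnhState : Type _ := Σ s : D.State, (D.circles s → ℤˣ)

/-- The chain space `[[D]] = ⨁ₛ V(s)` over `ℤ/2`. -/
abbrev Chain : Type _ := D.EnhState →₀ ZMod 2

instance : Finite D.EnhState := inferInstance

instance : Fintype D.EnhState := Fintype.ofFinite _

end LinkDiagram

/-- The basis vector `v_c` occurs in `m (v_a ⊗ v_b)`:
`v₊ ⊗ v₊ ↦ v₊`, `v₊ ⊗ v₋ ↦ v₋`, `v₋ ⊗ v₊ ↦ v₋`, `v₋ ⊗ v₋ ↦ 0`. -/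
def MulTerm (a b c : ℤˣ) : Prop :=
  (a = 1 ∧ b = 1 ∧ c = 1) ∨ (a = 1 ∧ b = -1 ∧ c = -1) ∨ (a = -1 ∧ b = 1 ∧ c = -1)

/-- The basis vector `v_b ⊗ v_c` occurs in `Δ v_a`:
`v₊ ↦ v₊ ⊗ v₋ + v₋ ⊗ v₊`, `v₋ ↦ v₋ ⊗ v₋`. -/
def ComulTerm (a b c : ℤˣ) : Prop :=
  (a = 1 ∧ b = 1 ∧ c = -1) ∨ (a = 1 ∧ b = -1 ∧ c = 1) ∨ (a = -1 ∧ b = -1 ∧ c = -1)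

namespace LinkDiagram

variable {S : Type*} [TopologicalSpace S] [ChartedSpace ℂ S] (D : LinkDiagram S)

/-- The circle passes through the disc around the crossing `c`. -/
def Meets (c : Fin D.n) (C : Set S) : Prop := ¬ Disjoint C (D.disc c)

/-- Changing the resolution of `c` merges two circles, and `y` occurs in `m` of `x` on them. -/
def MergeTerm (c : Fin D.n) (x y : D.EnhState) : Prop :=
  ∃ (a b : D.circles x.1) (g : D.circles y.1), a ≠ b ∧
    (∀ C : D.circles x.1, D.Meets c C ↔ C = a ∨ C = b) ∧
    (∀ C : D.circles y.1, D.Meets c C ↔ C = g) ∧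
    MulTerm (x.2 a) (x.2 b) (y.2 g)

/-- Changing the resolution of `c` splits a circle, and `y` occurs in `Δ` of `x` on it. -/
def SplitTerm (c : Fin D.n) (x y : D.EnhState) : Prop :=
  ∃ (g : D.circles x.1) (a b : D.circles y.1), a ≠ b ∧
    (∀ C : D.circles x.1, D.Meets c C ↔ C = g) ∧
    (∀ C : D.circles y.1, D.Meets c C ↔ C = a ∨ C = b) ∧
    ComulTerm (x.2 g) (y.2 a) (y.2 b)

/-- The basis vector `y` occurs in the image of `x` under the partial differential of the edge
of the state cube that changes the resolution of the crossing `c` from `0` to `1`: on the circles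
away from `c` (which are circles of both resolutions) it is the identity, on the circles
through `c` it is `m` or `Δ`. -/
def PartialTerm (c : Fin D.n) (x y : D.EnhState) : Prop :=
  x.1 c = false ∧ y.1 = Function.update x.1 c true ∧
    (∀ (C : Set S) (hx : C ∈ D.circles x.1) (hy : C ∈ D.circles y.1), ¬ D.Meets c C →
      x.2 ⟨C, hx⟩ = y.2 ⟨C, hy⟩) ∧
    (D.MergeTerm c x y ∨ D.SplitTerm c x y)

open Classical in
/-- The sum of the partial differentials of all edges of the state cube that change the
resolution of the crossing `c`. -/
def partialDiff (c : Fin D.n) : D.Chain →ₗ[ZMod 2] D.Chain :=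
  Finsupp.linearCombination (ZMod 2) fun x =>
    ∑ y : D.EnhState with D.PartialTerm c x y, Finsupp.single y 1

/-- The Khovanov differential `d`, the sum of all partial differentials. -/
def diff : D.Chain →ₗ[ZMod 2] D.Chain := ∑ c, D.partialDiff c

variable {D}

/-- The homological grading `β(s) - n₋`, where `β(s)` is the number of `1`s in `s`. -/
def LinkOrientation.homGrading (o : D.LinkOrientation) (x : D.EnhState) : ℤ :=
  ({c | x.1 c = true}.ncard : ℤ) - o.nNeg

/-- The quantum grading `∑ deg xᵢ + β(s) + n₊ - 2 n₋`. -/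
def LinkOrientation.quantumGrading (o : D.LinkOrientation) (x : D.EnhState) : ℤ :=
  (∑ C, (x.2 C : ℤ)) + {c | x.1 c = true}.ncard + o.nPos - 2 * o.nNeg

/-- The homotopical grading `∑ deg(xᵢ) [Cᵢ]`. -/
def SourceSink.homotopicalGrading (τ : D.SourceSink) (x : D.EnhState) : HGroup S :=
  ∑ C, (x.2 C : ℤ) • τ.circleClass (C : Set S)

open Classical in
/-- The part `d_h` of the differential `d` that preserves the homotopical grading. -/
def SourceSink.diffH (τ : D.SourceSink) : D.Chain →ₗ[ZMod 2] D.Chain :=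
  Finsupp.linearCombination (ZMod 2) fun x =>
    (D.diff (Finsupp.single x 1)).filter fun y =>
      τ.homotopicalGrading y = τ.homotopicalGrading x

variable (D)

/-- The homogeneous part `C(D)_{i,j,h}`. -/
def gradedPart (o : D.LinkOrientation) (τ : D.SourceSink) (i j : ℤ) (h : HGroup S) :
    Submodule (ZMod 2) D.Chain :=
  Finsupp.supported (ZMod 2) (ZMod 2)
    {x | o.homGrading x = i ∧ o.quantumGrading x = j ∧ τ.homotopicalGrading x = h}

/-- The cycles of degree `(i, j, h)`. -/
def cycles (o : D.LinkOrientation) (τ : D.SourceSink) (i j : ℤ) (h : HGroup S) :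
    Submodule (ZMod 2) D.Chain :=
  D.gradedPart o τ i j h ⊓ LinearMap.ker τ.diffH

/-- The boundaries of degree `(i, j, h)`, that is, the image under `d_h` of the homogeneous part of
degree `(i - 1, j, h)`, as a subspace of the cycles. (As `d_h` has square zero, this image consists
of cycles; writing it as a preimage under the inclusion makes the definition independent of a
proof of this.) -/
def boundaries (o : D.LinkOrientation) (τ : D.SourceSink) (i j : ℤ) (h : HGroup S) :
    Submodule (ZMod 2) (D.cycles o τ i j h) :=
  Submodule.comap (D.cycles o τ i j h).subtype ((D.gradedPart o τ (i - 1) j h).map τ.diffH)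

/-- The homotopical Khovanov homology `Kh_h(D)_{i,j,h}`: cycles modulo boundaries. -/
abbrev Kh (o : D.LinkOrientation) (τ : D.SourceSink) (i j : ℤ) (h : HGroup S) : Type _ :=
  D.cycles o τ i j h ⧸ D.boundaries o τ i j h

end LinkDiagram

end HomotopicalKhovanov

end

noncomputable section

namespace HomotopicalKhovanov

/-! ### Loops with the same image -/

/-! The chain space and the full differential `diff` involve no orientation. Orientations enter only
through the gradings: the link orientation through `nPos` and `nNeg`, the source-sink structure
through the classes of the circles.

Reversing all components keeps every crossing sign, hence all gradings. For two source-sink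
structures the class of each circle is the same: along a circle they agree on all edges or differ on
all edges (`SourceSink.agree_on_circle`), so a parametrization for one gives, possibly after
reversal, a parametrization for the other. Moreover any two injective loops with the same image
differ by a homeomorphism of the circle, which has degree `1` or `-1`, and `[γ] = [-γ]`
(`HGroup.cls_eq_of_range_eq`). Hence the homotopical grading does not change, nor does `diffH`
(`nonempty_Kh_equiv_of_gradings_eq`).

For the mirror image, complementing the state gives the same circles. Exchanging `v₊` and `v₋` turns
the structure constants of `m` into those of `Δ` with input and output interchanged. So the
differential of the mirror image is the transpose of that of `D`, and all three gradings change
sign. Over a field a matrix and its transpose have the same rank, so the homologies in opposite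
degrees have equal dimension (`finrank_homology_transpose`). The dimension count keeps track of the
rank of `d ∘ d`, which is also invariant under transposition, so `d ∘ d = 0` is not needed. -/

theorem exists_circle_lift (φ : C(Circle, Circle)) :
    ∃ θ : C(ℝ, ℝ), ∀ x, Circle.exp (θ x) = φ (Circle.exp x) := by
  obtain ⟨e, he⟩ : ∃ e : ℝ, Circle.exp e = φ (Circle.exp 0) := by
    obtain ⟨e, he⟩ := Circle.exp_surjective (φ (Circle.exp 0))
    exact ⟨e, he⟩
  obtain ⟨θ, ⟨-, hθ⟩, -⟩ := Circle.isCoveringMap_exp.existsUnique_continuousMap_lifts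
    (φ.comp ⟨Circle.exp, Circle.exp.continuous⟩) (0 : ℝ) e he
  exact ⟨θ, fun x => congrFun hθ x⟩

/-- A continuous function that takes values in `2πℤ` is constant. -/
theorem exists_const_of_exp_eq_one (u : ℝ → ℝ) (hu : Continuous u)
    (h : ∀ x, Circle.exp (u x) = 1) : ∃ k : ℤ, ∀ x, u x = k * (2 * Real.pi) := by
  have h0 := h 0
  rw [← Circle.exp_zero, Circle.exp_eq_exp] at h0
  obtain ⟨k, hk⟩ := h0
  refine ⟨k, fun x => ?_⟩
  -- Both `u` and the constant `u 0` lift the constant map `1`; lifts that agree at one point are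
  -- equal.
  have := Circle.isCoveringMap_exp.eq_of_comp_eq (g₁ := u) (g₂ := fun _ => u 0) hu continuous_const
    (funext fun y => by simp [h y, h 0]) 0 rfl
  rw [congrFun this x, hk]
  ring

/-- The integer `k` is the degree of `φ`: `θ (x + 2π) - θ x` lies in `2πℤ`, so it is constant. -/
theorem exists_lift_degree (φ : C(Circle, Circle)) (θ : C(ℝ, ℝ))
    (hθ : ∀ x, Circle.exp (θ x) = φ (Circle.exp x)) :
    ∃ k : ℤ, ∀ x, θ (x + 2 * Real.pi) = θ x + k * (2 * Real.pi) := by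
  obtain ⟨k, hk⟩ := exists_const_of_exp_eq_one (fun x => θ (x + 2 * Real.pi) - θ x)
    (by fun_prop) (fun x => by
      rw [Circle.exp_sub, hθ, hθ, Circle.exp_add_two_pi, div_self'])
  exact ⟨k, fun x => by rw [← hk x]; ring⟩

theorem lift_add_int_mul {θ : ℝ → ℝ} {k : ℤ}
    (hk : ∀ x, θ (x + 2 * Real.pi) = θ x + k * (2 * Real.pi)) (x : ℝ) (l : ℤ) :
    θ (x + l * (2 * Real.pi)) = θ x + k * l * (2 * Real.pi) := by
  induction l using Int.induction_on with
  | zero => simp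
  | succ n ih =>
    have := hk (x + n * (2 * Real.pi))
    push_cast at ih ⊢
    rw [show x + (n + 1) * (2 * Real.pi) = x + n * (2 * Real.pi) + 2 * Real.pi by ring, this, ih]
    ring
  | pred n ih =>
    have := hk (x + (-n - 1) * (2 * Real.pi))
    push_cast at ih ⊢
    rw [show x + (-n - 1) * (2 * Real.pi) + 2 * Real.pi = x + -n * (2 * Real.pi) by ring, ih]
      at this
    linarith

/-- The map `z ↦ z ^ k` of the circle. -/
def circlePow (k : ℤ) : C(Circle, Circle) := ⟨fun z => z ^ k, continuous_zpow k⟩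

/-- Since `θ x - k x` is `2π`-periodic, it descends to a function `v` on the circle, and `φ z = z ^
k * exp (v z)`. Scaling `v` by `t ∈ [0, 1]` is the homotopy. -/
theorem homotopic_circlePow (φ : C(Circle, Circle)) (θ : C(ℝ, ℝ)) (k : ℤ)
    (hθ : ∀ x, Circle.exp (θ x) = φ (Circle.exp x))
    (hk : ∀ x, θ (x + 2 * Real.pi) = θ x + k * (2 * Real.pi)) :
    (circlePow k).Homotopic φ := by
  have hper : Function.Periodic (fun x => θ x - k * x) (2 * Real.pi) := fun x => by
    simp only [hk]
    ring
  let v : Circle → ℝ := fun z => hper.lift (AddCircle.homeomorphCircle'.symm z)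
  have hv : Continuous v := by
    refine Continuous.comp ?_ AddCircle.homeomorphCircle'.symm.continuous
    exact continuous_quot_lift _ (by fun_prop)
  have hexp : ∀ x, v (Circle.exp x) = θ x - k * x := fun x => by
    simp only [v, ← AddCircle.homeomorphCircle'_apply_mk, Homeomorph.symm_apply_apply]
    exact hper.lift_coe x
  refine ⟨⟨⟨fun p => p.2 ^ k * Circle.exp (p.1 * v p.2), ?_⟩, ?_, ?_⟩⟩
  · have := Circle.exp.continuous
    fun_prop
  · intro z
    simp [circlePow]
  · intro z
    obtain ⟨x, rfl⟩ := Circle.exp_surjective z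
    simp only [Set.Icc.coe_one, one_mul, hexp, ← hθ]
    rw [← Circle.exp_intCast_mul, ← Circle.exp_add]
    congr 1
    ring

/-- A homeomorphism of the circle is homotopic to the identity or to the inversion. -/
theorem homeomorph_homotopic (φ : Circle ≃ₜ Circle) :
    (circlePow 1).Homotopic (φ : C(Circle, Circle)) ∨
      (circlePow (-1)).Homotopic (φ : C(Circle, Circle)) := by
  obtain ⟨θ, hθ⟩ := exists_circle_lift (φ : C(Circle, Circle))
  obtain ⟨k, hk⟩ := exists_lift_degree _ θ hθ
  obtain ⟨η, hη⟩ := exists_circle_lift (φ.symm : C(Circle, Circle))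
  obtain ⟨l, hl⟩ := exists_lift_degree _ η hη
  -- `θ ∘ η` lifts the identity, so it is a translation. Comparing its values at `0` and `2π` gives
  -- `k * l = 1` for the degrees of `φ` and its inverse.
  obtain ⟨m, hm⟩ := exists_const_of_exp_eq_one (fun x => θ (η x) - x) (by fun_prop) (fun x => by
    simp [Circle.exp_sub, hθ, hη])
  have h1 := hm (0 + 2 * Real.pi)
  have h0 := hm 0
  simp only [hl, lift_add_int_mul hk] at h1
  have hkl : (k : ℝ) * l = 1 := by
    have : ((k : ℝ) * l - 1) * (2 * Real.pi) = 0 := by linarith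
    have := (mul_eq_zero.1 this).resolve_right (by positivity)
    linarith
  have hkl' : k * l = 1 := by exact_mod_cast hkl
  rcases Int.isUnit_iff.1 (IsUnit.of_mul_eq_one l hkl') with rfl | rfl
  · exact Or.inl (homotopic_circlePow _ θ _ hθ hk)
  · exact Or.inr (homotopic_circlePow _ θ _ hθ hk)

section

variable {S : Type*} [TopologicalSpace S]

theorem HGroup.cls_eq_of_homotopic {f g : C(Circle, S)} (h : f.Homotopic g) :
    HGroup.cls f = HGroup.cls g := by
  have : LoopClass.mk f = LoopClass.mk g := Quotient.sound h
  rw [HGroup.cls, HGroup.cls, this]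

theorem HGroup.cls_revLoop (f : C(Circle, S)) : HGroup.cls (revLoop f) = HGroup.cls f := by
  symm
  refine QuotientAddGroup.eq_iff_sub_mem.2 (AddSubgroup.subset_closure (Or.inr ⟨f, rfl⟩))

/-- The element `[C]` of `𝔥` does not depend on the parametrization of the simple closed
curve `C`. -/
theorem HGroup.cls_eq_of_range_eq [T2Space S] {f g : C(Circle, S)} (hf : Function.Injective f)
    (hg : Function.Injective g) (h : Set.range f = Set.range g) :
    HGroup.cls f = HGroup.cls g := by
  -- The circle is compact and `S` is Hausdorff, so `f` and `g` are homeomorphisms onto their common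
  -- image, and `φ = f⁻¹ ∘ g`.
  let e := (f.continuous.isClosedEmbedding hf).isEmbedding.toHomeomorph
  let e' := (g.continuous.isClosedEmbedding hg).isEmbedding.toHomeomorph
  let φ : Circle ≃ₜ Circle := (e'.trans (Homeomorph.setCongr h.symm)).trans e.symm
  have hφ : f.comp (φ : C(Circle, Circle)) = g := by
    ext z
    have : e (φ z) = Homeomorph.setCongr h.symm (e' z) := by simp [φ]
    exact congrArg Subtype.val this
  rcases homeomorph_homotopic φ with H | H
  · have := HGroup.cls_eq_of_homotopic ((ContinuousMap.Homotopic.refl f).comp H)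
    rw [hφ] at this
    rw [← this]
    congr 1
    ext z
    simp [circlePow]
  · have := HGroup.cls_eq_of_homotopic ((ContinuousMap.Homotopic.refl f).comp H)
    rw [hφ] at this
    rw [← this, ← HGroup.cls_revLoop f]
    congr 1
    ext z
    simp [circlePow, revLoop]

end

end HomotopicalKhovanov

end

noncomputable section

namespace HomotopicalKhovanov

/-! ### Dimension of homology and transposition -/

section LinearAlgebra

variable {K : Type*} [Field K]

theorem finrank_inf_ker_add_finrank_map {E : Type*} [AddCommGroup E] [Module K E]
    [FiniteDimensional K E] (d : E →ₗ[K] E) (V : Submodule K E) :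
    Module.finrank K ↥(V ⊓ LinearMap.ker d) + Module.finrank K (V.map d) = Module.finrank K V := by
  have h := (d.domRestrict V).finrank_range_add_finrank_ker
  rw [LinearMap.range_domRestrict, LinearMap.ker_domRestrict,
    ← Submodule.finrank_map_subtype_eq, Submodule.map_comap_subtype] at h
  omega

/-- The dimension of the cycles in `V` modulo the boundaries of elements of `W`. -/
def homologyRank {E : Type*} [AddCommGroup E] [Module K E] (d : E →ₗ[K] E) (V W : Submodule K E) :
    ℕ :=
  Module.finrank K (↥(V ⊓ LinearMap.ker d) ⧸
    Submodule.comap (V ⊓ LinearMap.ker d).subtype (Submodule.map d W))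

/-- Rank-nullity for `d` on `V` and on `d W`. As `d ∘ d = 0` is not assumed, the boundaries are `d W
⊓ ker d`, of dimension `dim (d W) - dim (d (d W))`. -/
theorem finrank_homology {E : Type*} [AddCommGroup E] [Module K E] [FiniteDimensional K E]
    (d : E →ₗ[K] E) (V W : Submodule K E) (hW : W.map d ≤ V) :
    homologyRank d V W +
      Module.finrank K (V.map d) + Module.finrank K (W.map d) =
    Module.finrank K V + Module.finrank K ((W.map d).map d) := by
  rw [homologyRank]
  have h1 := finrank_inf_ker_add_finrank_map d V
  have h2 := finrank_inf_ker_add_finrank_map d (W.map d)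
  have h3 := Submodule.finrank_quotient_add_finrank
    ((W.map d).comap (V ⊓ LinearMap.ker d).subtype)
  rw [← Submodule.finrank_map_subtype_eq, Submodule.map_comap_subtype, inf_right_comm,
    inf_eq_right.2 hW] at h3
  omega

variable {X Y : Type*} [Fintype X] [Fintype Y]

open Classical in
/-- The matrix of `T'` is, after reindexing along `e`, the transpose of the matrix of `T`. -/
def IsTransposeAlong (e : X ≃ Y) (T : (X →₀ K) →ₗ[K] (X →₀ K)) (T' : (Y →₀ K) →ₗ[K] (Y →₀ K)) :
    Prop :=
  LinearMap.toMatrix Finsupp.basisSingleOne Finsupp.basisSingleOne T' =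
    (LinearMap.toMatrix Finsupp.basisSingleOne Finsupp.basisSingleOne T).transpose.submatrix
      e.symm e.symm

theorem isTransposeAlong_iff {e : X ≃ Y} {T : (X →₀ K) →ₗ[K] (X →₀ K)}
    {T' : (Y →₀ K) →ₗ[K] (Y →₀ K)} :
    IsTransposeAlong e T T' ↔
      ∀ x y, T' (Finsupp.single (e x) 1) (e y) = T (Finsupp.single y 1) x := by
  classical
  rw [IsTransposeAlong, ← Matrix.ext_iff]
  simp only [LinearMap.toMatrix_apply, Matrix.submatrix_apply, Matrix.transpose_apply,
    Finsupp.coe_basisSingleOne, Finsupp.basisSingleOne_repr, LinearEquiv.refl_apply]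
  constructor
  · intro h x y
    simpa using h (e y) (e x)
  · intro h i j
    simpa using h (e.symm j) (e.symm i)

theorem IsTransposeAlong.comp {e : X ≃ Y} {T U : (X →₀ K) →ₗ[K] (X →₀ K)}
    {T' U' : (Y →₀ K) →ₗ[K] (Y →₀ K)} (h : IsTransposeAlong e T T')
    (h' : IsTransposeAlong e U U') : IsTransposeAlong e (T ∘ₗ U) (U' ∘ₗ T') := by
  classical
  rw [IsTransposeAlong] at h h' ⊢
  rw [LinearMap.toMatrix_comp _ Finsupp.basisSingleOne, h, h',
    LinearMap.toMatrix_comp _ Finsupp.basisSingleOne, Matrix.transpose_mul,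
    Matrix.submatrix_mul_equiv]

/-- Row rank equals column rank. -/
theorem IsTransposeAlong.finrank_range {e : X ≃ Y} {T : (X →₀ K) →ₗ[K] (X →₀ K)}
    {T' : (Y →₀ K) →ₗ[K] (Y →₀ K)} (h : IsTransposeAlong e T T') :
    Module.finrank K (LinearMap.range T') = Module.finrank K (LinearMap.range T) := by
  classical
  rw [IsTransposeAlong] at h
  have h1 := congrArg Matrix.rank h
  rw [Matrix.rank_submatrix, Matrix.rank_transpose,
    Matrix.rank_eq_finrank_range_toLin _ Finsupp.basisSingleOne Finsupp.basisSingleOne,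
    Matrix.rank_eq_finrank_range_toLin _ Finsupp.basisSingleOne Finsupp.basisSingleOne,
    Matrix.toLin_toMatrix, Matrix.toLin_toMatrix] at h1
  exact h1

open Classical in
/-- The projection onto the span of the basis vectors in `P`. -/
def coordProj (K : Type*) [Field K] {X : Type*} (P : Set X) : (X →₀ K) →ₗ[K] (X →₀ K) :=
  (Finsupp.supported K K P).subtype ∘ₗ Finsupp.restrictDom K K P

omit [Fintype X] in
theorem range_coordProj (P : Set X) :
    LinearMap.range (coordProj K P) = Finsupp.supported K K P := by
  classical
  rw [coordProj, LinearMap.range_comp, Finsupp.range_restrictDom, Submodule.map_top,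
    Submodule.range_subtype]

open Classical in
omit [Fintype X] in
theorem coordProj_apply (P : Set X) (f : X →₀ K) (x : X) :
    coordProj K P f x = if x ∈ P then f x else 0 := by
  simp [coordProj, Finsupp.filter_apply]

theorem isTransposeAlong_coordProj (e : X ≃ Y) {P : Set X} {Q : Set Y}
    (h : ∀ x, e x ∈ Q ↔ x ∈ P) : IsTransposeAlong e (coordProj K P) (coordProj K Q) := by
  classical
  rw [isTransposeAlong_iff]
  intro x y
  simp only [coordProj_apply, h, Finsupp.single_apply, e.apply_eq_iff_eq]
  by_cases hxy : x = y
  · subst hxy; rfl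
  · simp [hxy, Ne.symm hxy]

omit [Fintype X] in
-- Homogeneity of `d` as an identity of operators, a form that can be transposed. The equivalence in
-- the hypothesis makes the matrix of `d` block diagonal for `P`, `Q` and their complements.
theorem comp_coordProj {d : (X →₀ K) →ₗ[K] (X →₀ K)} {P Q : Set X}
    (h : ∀ x y, d (Finsupp.single x 1) y ≠ 0 → (x ∈ P ↔ y ∈ Q)) :
    d ∘ₗ coordProj K P = coordProj K Q ∘ₗ d := by
  classical
  ext x y
  simp only [LinearMap.comp_apply, Finsupp.lsingle_apply, coordProj_apply]
  have : coordProj K P (Finsupp.single x 1) = if x ∈ P then Finsupp.single x 1 else 0 := by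
    ext z
    rw [coordProj_apply, Finsupp.single_apply]
    by_cases hxz : x = z
    · subst hxz
      by_cases hx : x ∈ P <;> simp [hx]
    · split_ifs <;> simp [hxz]
  rw [this]
  by_cases h0 : d (Finsupp.single x 1) y = 0
  · split_ifs <;> simp [h0]
  · have := h x y h0
    by_cases hx : x ∈ P
    · simp [hx, this.1 hx]
    · simp [hx, mt this.2 hx]

omit [Fintype X] in
theorem map_supported_eq (d : (X →₀ K) →ₗ[K] (X →₀ K)) (P : Set X) :
    (Finsupp.supported K K P).map d = LinearMap.range (d ∘ₗ coordProj K P) := by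
  rw [LinearMap.range_comp, range_coordProj]

omit [Fintype X] in
-- Every dimension besides that of the homology is now the rank of a composite of `d` and coordinate
-- projections, to which `IsTransposeAlong.finrank_range` applies.
theorem finrank_homology_supported [Finite X] {d : (X →₀ K) →ₗ[K] (X →₀ K)} {P₀ P₁ : Set X}
    (c₀ : d ∘ₗ coordProj K P₀ = coordProj K P₁ ∘ₗ d) :
    homologyRank d (Finsupp.supported K K P₁) (Finsupp.supported K K P₀) +
        Module.finrank K (LinearMap.range (d ∘ₗ coordProj K P₁)) +
        Module.finrank K (LinearMap.range (d ∘ₗ coordProj K P₀)) =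
      Module.finrank K (LinearMap.range (coordProj K P₁)) +
        Module.finrank K (LinearMap.range ((d ∘ₗ d) ∘ₗ coordProj K P₀)) := by
  have hW : (Finsupp.supported K K P₀).map d ≤ Finsupp.supported K K P₁ := by
    rw [map_supported_eq, c₀, ← range_coordProj P₁]
    exact LinearMap.range_comp_le_range _ _
  have h := finrank_homology d _ _ hW
  rw [LinearMap.comp_assoc, LinearMap.range_comp (d ∘ₗ coordProj K P₀) d, ← map_supported_eq,
    ← map_supported_eq, range_coordProj]
  exact h

/-- The homology of a graded endomorphism (of degree `1`) and that of its transpose have the same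
dimension. -/
theorem finrank_homology_transpose (e : X ≃ Y) {d : (X →₀ K) →ₗ[K] (X →₀ K)}
    {d' : (Y →₀ K) →ₗ[K] (Y →₀ K)} (hd : IsTransposeAlong e d d') {P₀ P₁ P₂ : Set X}
    {Q₀ Q₁ : Set Y} (h₀ : ∀ x y, d (Finsupp.single x 1) y ≠ 0 → (x ∈ P₀ ↔ y ∈ P₁))
    (h₁ : ∀ x y, d (Finsupp.single x 1) y ≠ 0 → (x ∈ P₁ ↔ y ∈ P₂))
    (hQ₀ : ∀ x, e x ∈ Q₀ ↔ x ∈ P₂) (hQ₁ : ∀ x, e x ∈ Q₁ ↔ x ∈ P₁) :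
    homologyRank d' (Finsupp.supported K K Q₁) (Finsupp.supported K K Q₀) =
      homologyRank d (Finsupp.supported K K P₁) (Finsupp.supported K K P₀) := by
  have c₀ := comp_coordProj h₀
  have c₁ := comp_coordProj h₁
  have c' : d' ∘ₗ coordProj K Q₀ = coordProj K Q₁ ∘ₗ d' := by
    refine comp_coordProj fun x y => ?_
    obtain ⟨x, rfl⟩ := e.surjective x
    obtain ⟨y, rfl⟩ := e.surjective y
    rw [isTransposeAlong_iff.1 hd, hQ₀, hQ₁]
    exact fun h => (h₁ y x h).symm
  have t₀ := isTransposeAlong_coordProj (K := K) e hQ₀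
  have t₁ := isTransposeAlong_coordProj (K := K) e hQ₁
  have r₁ := t₁.finrank_range
  have r₂ := (t₀.comp hd).finrank_range
  have r₃ := (t₁.comp hd).finrank_range
  have r₄ := ((t₀.comp hd).comp hd).finrank_range
  -- Moving the projections across `d` shows that the outgoing rank for `d'` is the incoming rank
  -- for `d` and conversely; the two occur symmetrically in the dimension formula.
  rw [← c₁] at r₂ r₄
  rw [← c₀] at r₃
  rw [LinearMap.comp_assoc, ← c₀] at r₄
  have f := finrank_homology_supported (c₀ := c₀)
  have f' := finrank_homology_supported (c₀ := c')
  rw [LinearMap.comp_assoc] at f f'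
  omega

end LinearAlgebra

end HomotopicalKhovanov

end

noncomputable section

namespace HomotopicalKhovanov

/-! ### Connected components of finite unions of closed sets -/

section

variable {X : Type*} [TopologicalSpace X]

/-- If intersecting members of a finite family of closed sets have the same colour, then so do all
members that are contained in a preconnected subset of the union. -/
theorem color_iff_of_preconnected {ι : Type*} [Finite ι] {P : ι → Set X}
    (hP : ∀ a, IsClosed (P a)) {color : ι → Prop}
    (h : ∀ a b, (P a ∩ P b).Nonempty → (color a ↔ color b)) {C : Set X} (hC : IsPreconnected C)
    (hCP : C ⊆ ⋃ a, P a) {a b : ι} (ha : P a ⊆ C) (hb : P b ⊆ C) (hane : (P a).Nonempty)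
    (hbne : (P b).Nonempty) : color a ↔ color b := by
  have hA : IsClosed (⋃ a ∈ {a | color a}, P a) := (Set.toFinite _).isClosed_biUnion fun a _ => hP a
  have hB : IsClosed (⋃ a ∈ {a | ¬ color a}, P a) :=
    (Set.toFinite _).isClosed_biUnion fun a _ => hP a
  -- The coloured and the uncoloured pieces form two closed sets that cover `C` and do not meet, so
  -- `C` lies in one of them.
  have key := isPreconnected_iff_subset_of_disjoint_closed.1 hC _ _ hA hB
    (fun p hp => by
      obtain ⟨c, hc⟩ := Set.mem_iUnion.1 (hCP hp)
      by_cases hcc : color c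
      · exact Or.inl (Set.mem_biUnion hcc hc)
      · exact Or.inr (Set.mem_biUnion hcc hc))
    (by
      rw [Set.eq_empty_iff_forall_notMem]
      rintro p ⟨-, hp, hp'⟩
      obtain ⟨c, hc, hpc⟩ := Set.mem_iUnion₂.1 hp
      obtain ⟨c', hc', hpc'⟩ := Set.mem_iUnion₂.1 hp'
      exact hc' ((h c c' ⟨p, hpc, hpc'⟩).1 hc))
  obtain ⟨p, hp⟩ := hane
  obtain ⟨q, hq⟩ := hbne
  rcases key with H | H
  · obtain ⟨c, hc, hpc⟩ := Set.mem_iUnion₂.1 (H (ha hp))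
    obtain ⟨c', hc', hqc⟩ := Set.mem_iUnion₂.1 (H (hb hq))
    exact iff_of_true ((h c a ⟨p, hpc, hp⟩).1 hc) ((h c' b ⟨q, hqc, hq⟩).1 hc')
  · obtain ⟨c, hc, hpc⟩ := Set.mem_iUnion₂.1 (H (ha hp))
    obtain ⟨c', hc', hqc⟩ := Set.mem_iUnion₂.1 (H (hb hq))
    exact iff_of_false (mt (h c a ⟨p, hpc, hp⟩).2 hc) (mt (h c' b ⟨q, hqc, hq⟩).2 hc')

theorem isClosed_connectedComponentIn {Y : Set X} (hY : IsClosed Y) (p : X) :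
    IsClosed (connectedComponentIn Y p) := by
  by_cases hp : p ∈ Y
  · refine isClosed_of_closure_subset ?_
    refine isPreconnected_connectedComponentIn.closure.subset_connectedComponentIn
      (subset_closure (mem_connectedComponentIn hp)) ?_
    exact hY.closure_subset_iff.2 (connectedComponentIn_subset Y p)
  · rw [connectedComponentIn_eq_empty hp]
    exact isClosed_empty

/-- A component of `Y` that is disjoint from `E` is also a component of `Z` if `Y` and `Z` agree
outside `E`. -/
theorem connectedComponentIn_eq_of_disjoint {Y Z E : Set X} (hY : IsClosed Y) (hE : IsClosed E)
    (hfin : ((fun p => connectedComponentIn Y p) '' Y).Finite) (hYZ : Y ⊆ Z ∪ E) (hZY : Z ⊆ Y ∪ E)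
    {p : X} (hp : p ∈ Y) (hd : Disjoint (connectedComponentIn Y p) E) :
    p ∈ Z ∧ connectedComponentIn Z p = connectedComponentIn Y p := by
  have hsub : connectedComponentIn Y p ⊆ Z := fun q hq =>
    (hYZ (connectedComponentIn_subset _ _ hq)).resolve_right (Set.disjoint_left.1 hd hq)
  have hpC := mem_connectedComponentIn hp
  refine ⟨hsub hpC, Set.Subset.antisymm ?_
    (isPreconnected_connectedComponentIn.subset_connectedComponentIn hpC hsub)⟩
  set T := ((fun p => connectedComponentIn Y p) '' Y) \ {connectedComponentIn Y p} with hT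
  have hK : IsClosed (⋃₀ T ∪ E) := by
    refine IsClosed.union ?_ hE
    rw [Set.sUnion_eq_biUnion]
    refine (hfin.subset Set.sdiff_subset).isClosed_biUnion ?_
    rintro _ ⟨⟨q, -, rfl⟩, -⟩
    exact isClosed_connectedComponentIn hY q
  have key := isPreconnected_iff_subset_of_disjoint_closed.1
    (isPreconnected_connectedComponentIn (x := p) (F := Z)) _ _
    (isClosed_connectedComponentIn hY p) hK
    (fun q hq => by
      rcases hZY (connectedComponentIn_subset _ _ hq) with hqY | hqE
      · by_cases h : connectedComponentIn Y q = connectedComponentIn Y p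
        · exact Or.inl (h ▸ mem_connectedComponentIn hqY)
        · exact Or.inr (Or.inl ⟨_, ⟨⟨q, hqY, rfl⟩, h⟩, mem_connectedComponentIn hqY⟩)
      · exact Or.inr (Or.inr hqE))
    (by
      rw [Set.eq_empty_iff_forall_notMem]
      rintro q ⟨-, hq, ⟨_, ⟨⟨r, -, rfl⟩, hr⟩, hq'⟩ | hq'⟩
      · exact hr ((connectedComponentIn_eq hq').trans (connectedComponentIn_eq hq).symm)
      · exact Set.disjoint_left.1 hd hq hq')
  rcases key with H | H
  · exact H
  · exfalso
    rcases H (mem_connectedComponentIn (hsub hpC)) with ⟨_, ⟨⟨r, -, rfl⟩, hr⟩, hq'⟩ | hq'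
    · exact hr (connectedComponentIn_eq hq')
    · exact Set.disjoint_left.1 hd hpC hq'

end

namespace LinkDiagram

variable {S : Type*} [TopologicalSpace S] [ChartedSpace ℂ S] {D : LinkDiagram S}

/-! ### Change of the source-sink structure -/

theorem smoothingArc_subset_disc (c : Fin D.n) (k : Fin 4) : D.smoothingArc c k ⊆ D.disc c :=
  Set.image_mono ((convex_closedBall (0 : ℂ) 1).segment_subset (by simp) (by simp))

theorem isCompact_disc (c : Fin D.n) : IsCompact (D.disc c) :=
  (isCompact_closedBall (0 : ℂ) 1).image_of_continuousOn
    ((D.chart c).continuousOn_symm.mono (D.ball_subset c))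

theorem isCompact_smoothingArc (c : Fin D.n) (k : Fin 4) : IsCompact (D.smoothingArc c k) := by
  refine IsCompact.image_of_continuousOn ?_ ((D.chart c).continuousOn_symm.mono
    (((convex_closedBall (0 : ℂ) 1).segment_subset (by simp) (by simp)).trans (D.ball_subset c)))
  rw [segment_eq_image_lineMap]
  exact isCompact_Icc.image AffineMap.lineMap_continuous

variable (D) in
/-- The pieces of the resolution `D_s`: the edges, and the smoothing arcs. -/
def piece (s : D.State) :
    D.Edge ⊕ {q : Fin D.n × Fin 4 // D.IsOver q.1 q.2 ↔ s q.1 = true} → Set S :=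
  Sum.elim (fun e => Set.range (D.edge e)) (fun q => D.smoothingArc q.1.1 q.1.2)

theorem resolution_eq_iUnion_piece (s : D.State) : D.resolution s = ⋃ a, D.piece s a := by
  rw [Set.iUnion_sum]
  rfl

theorem isCompact_piece (s : D.State) (a) : IsCompact (D.piece s a) := by
  rcases a with e | q
  · exact isCompact_range (D.edge e).continuous
  · exact isCompact_smoothingArc _ _

theorem isClosed_resolution [T2Space S] (s : D.State) : IsClosed (D.resolution s) := by
  rw [resolution_eq_iUnion_piece]
  exact isClosed_iUnion_of_finite fun a => (isCompact_piece s a).isClosed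

/-- An edge can meet a closed disc only in its endpoints, and these lie at the darts given by
`attach`. -/
theorem arc_mem_disc {e : Fin D.numArcs} {t : I} {c : Fin D.n} (h : D.arc e t ∈ D.disc c) :
    ∃ k, (D.attach.symm (c, k)).1 = e := by
  have key : ∀ b, D.arc e t = (D.chart (D.attach (e, b)).1).symm
      (Complex.I ^ ((D.attach (e, b)).2 : ℕ)) → ∃ k, (D.attach.symm (c, k)).1 = e := by
    intro b hb
    have hc : (D.attach (e, b)).1 = c := by
      by_contra hne
      refine Set.disjoint_left.1 (D.discs_disjoint _ _ hne) ?_ h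
      rw [hb]
      exact Set.mem_image_of_mem _ (by simp)
    exact ⟨(D.attach (e, b)).2, by rw [← hc]; simp⟩
  by_cases h0 : t = 0
  · exact key false (h0 ▸ D.arc_zero e)
  by_cases h1 : t = 1
  · exact key true (h1 ▸ D.arc_one e)
  exact absurd h (D.arc_notMem_disc e c t h0 h1)

theorem eq_of_edge_eq {e e' : D.Edge} {t t' : I} (h : D.edge e t = D.edge e' t') : e = e' := by
  rcases e with e | l <;> rcases e' with e' | l'
  · rw [(D.arc_injective e e' t t' h).1]
  · exact absurd h (D.arc_ne_loop e l' t t')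
  · exact absurd h.symm (D.arc_ne_loop e' l t' t)
  -- `loop_injective` excludes the parameter `1`, which is traded for `0`.
  · have key : ∀ (l : Fin D.numLoops) (t : I), ∃ u, u ≠ 1 ∧ D.loop l u = D.loop l t := by
      intro l t
      by_cases ht : t = 1
      · exact ⟨0, by simp, by rw [ht, D.loop_closed]⟩
      · exact ⟨t, ht, rfl⟩
    obtain ⟨u, hu, hut⟩ := key l t
    obtain ⟨u', hu', hut'⟩ := key l' t'
    rw [(D.loop_injective l l' u u' hu hu' (by rw [hut, hut']; exact h)).1]

/-- Incoming and outgoing darts alternate around a crossing, so one dart determines the other three: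
two structures agree at all four darts or at none. -/
theorem SourceSink.agree_iff (τ τ' : D.SourceSink) (c : Fin D.n) (k : Fin 4) :
    τ.dir (Sum.inl (D.attach.symm (c, k)).1) = τ'.dir (Sum.inl (D.attach.symm (c, k)).1) ↔
      τ.dir (Sum.inl (D.attach.symm (c, 0)).1) = τ'.dir (Sum.inl (D.attach.symm (c, 0)).1) := by
  have out : ∀ k, τ.dir (Sum.inl (D.attach.symm (c, k)).1) =
      τ'.dir (Sum.inl (D.attach.symm (c, k)).1) ↔
        (τ.dir.Outgoing c k ↔ τ'.dir.Outgoing c k) := by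
    intro k
    simp only [EdgeOrientation.Outgoing]
    cases τ.dir (Sum.inl (D.attach.symm (c, k)).1) <;>
      cases τ'.dir (Sum.inl (D.attach.symm (c, k)).1) <;>
      cases (D.attach.symm (c, k)).2 <;> simp
  have step : ∀ k, (τ.dir.Outgoing c (k + 1) ↔ τ'.dir.Outgoing c (k + 1)) ↔
      (τ.dir.Outgoing c k ↔ τ'.dir.Outgoing c k) := by
    intro k
    rw [τ.adjacent, τ'.adjacent, not_iff_not]
  rw [out, out]
  have h1 := step 0
  have h2 := step 1
  have h3 := step 2
  fin_cases k
  · rfl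
  · exact h1
  · exact h2.trans h1
  · exact h3.trans (h2.trans h1)

/-- On the edges of a circle, two source-sink structures agree everywhere or nowhere. -/
theorem SourceSink.agree_on_circle [T2Space S] (τ τ' : D.SourceSink) {s : D.State} {C : Set S}
    (hC : C ∈ D.circles s) {e e' : D.Edge} (he : Set.range (D.edge e) ⊆ C)
    (he' : Set.range (D.edge e') ⊆ C) : τ.dir e = τ'.dir e ↔ τ.dir e' = τ'.dir e' := by
  obtain ⟨p, hp, rfl⟩ := hC
  -- The colour is agreement of `τ` and `τ'`. A smoothing arc is tested at dart `0` of its crossing,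
  -- which by `SourceSink.agree_iff` is as good as any other dart.
  let color : D.Edge ⊕ {q : Fin D.n × Fin 4 // D.IsOver q.1 q.2 ↔ s q.1 = true} → Prop :=
    Sum.elim (fun e => τ.dir e = τ'.dir e) (fun q =>
      τ.dir (Sum.inl (D.attach.symm (q.1.1, 0)).1) = τ'.dir (Sum.inl (D.attach.symm (q.1.1, 0)).1))
  have mixed : ∀ (e : D.Edge) q, (D.piece s (Sum.inl e) ∩ D.piece s (Sum.inr q)).Nonempty →
      (color (Sum.inl e) ↔ color (Sum.inr q)) := by
    rintro (e | l) q ⟨x, ⟨t, rfl⟩, hx⟩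
    · obtain ⟨k, rfl⟩ := arc_mem_disc (smoothingArc_subset_disc _ _ hx)
      exact SourceSink.agree_iff τ τ' q.1.1 k
    · exact absurd (smoothingArc_subset_disc _ _ hx) (D.loop_notMem_disc l _ t)
  refine color_iff_of_preconnected (P := D.piece s) (color := color)
    (a := Sum.inl e) (b := Sum.inl e') (fun a => (isCompact_piece s a).isClosed) ?_
    (isPreconnected_connectedComponentIn (x := p) (F := D.resolution s)) ?_ he he'
    (Set.range_nonempty _) (Set.range_nonempty _)
  · rintro (e | q) (e' | q') hne
    · obtain ⟨x, ⟨t, rfl⟩, ⟨t', ht'⟩⟩ := hne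
      rw [eq_of_edge_eq ht']
    · exact mixed e q' hne
    · rw [Set.inter_comm] at hne
      exact (mixed e' q hne).symm
    · obtain ⟨x, hx, hx'⟩ := hne
      have : q.1.1 = q'.1.1 := by
        by_contra hcc
        exact Set.disjoint_left.1 (D.discs_disjoint _ _ hcc) (smoothingArc_subset_disc _ _ hx)
          (smoothingArc_subset_disc _ _ hx')
      simp only [color, Sum.elim_inr, this]
  · rw [← resolution_eq_iUnion_piece]
    exact connectedComponentIn_subset _ _

/-- Needed because `circleClass` takes the default value `0` when there is no parametrization: both
structures must fall into the same case. The same loop works if they agree along the circle, and the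
reversed loop if they are opposite. -/
theorem SourceSink.exists_parametrizes [T2Space S] (τ τ' : D.SourceSink) {s : D.State}
    {C : Set S} (hC : C ∈ D.circles s) (h : ∃ f, τ.Parametrizes C f) :
    ∃ f, τ'.Parametrizes C f := by
  obtain ⟨f, hinj, hrange, hf⟩ := h
  by_cases hag : ∃ e : D.Edge, Set.range (D.edge e) ⊆ C ∧ τ.dir e = τ'.dir e
  · obtain ⟨e₀, he₀, hag⟩ := hag
    refine ⟨f, hinj, hrange, fun e he => ?_⟩
    rw [← (SourceSink.agree_on_circle τ τ' hC he₀ he).1 hag]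
    exact hf e he
  · push Not at hag
    refine ⟨revLoop f, ?_, ?_, fun e he => ?_⟩
    · exact hinj.comp inv_injective
    · rw [← hrange]
      exact inv_surjective.range_comp f
    · obtain ⟨θ, hθ, hmono, hedge⟩ := hf e he
      refine ⟨fun t => -θ t, hθ.neg, ?_, fun t => ?_⟩
      · have := hag e he
        cases hτ : τ.dir e <;> cases hτ' : τ'.dir e <;>
          simp_all only [ne_eq, not_true_eq_false, Bool.false_eq_true, if_true, if_false]
        · exact hmono.neg
        · exact hmono.neg
      · rw [← hedge t]
        simp [revLoop]

/-- The homotopy class of a circle of a resolution does not depend on the source-sink structure. -/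
theorem SourceSink.circleClass_eq [T2Space S] (τ τ' : D.SourceSink) {s : D.State}
    {C : Set S} (hC : C ∈ D.circles s) : τ.circleClass C = τ'.circleClass C := by
  by_cases h : ∃ f, τ.Parametrizes C f
  · have h' := SourceSink.exists_parametrizes τ τ' hC h
    rw [SourceSink.circleClass, SourceSink.circleClass, dif_pos h, dif_pos h']
    -- The two chosen loops may be unrelated as parametrizations; having the same image suffices.
    exact HGroup.cls_eq_of_range_eq h.choose_spec.1 h'.choose_spec.1
      (h.choose_spec.2.1.trans h'.choose_spec.2.1.symm)
  · have h' := mt (SourceSink.exists_parametrizes τ' τ hC) h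
    rw [SourceSink.circleClass, SourceSink.circleClass, dif_neg h, dif_neg h']

theorem SourceSink.homotopicalGrading_eq [T2Space S] (τ τ' : D.SourceSink) :
    τ.homotopicalGrading = τ'.homotopicalGrading := by
  funext x
  simp only [SourceSink.homotopicalGrading]
  exact Finset.sum_congr rfl fun C _ => by rw [SourceSink.circleClass_eq τ τ' C.2]

open Classical in
theorem SourceSink.diffH_single_apply (τ : D.SourceSink) (x y : D.EnhState) :
    τ.diffH (Finsupp.single x 1) y =
      if τ.homotopicalGrading y = τ.homotopicalGrading x then D.diff (Finsupp.single x 1) y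
      else 0 := by
  rw [SourceSink.diffH, Finsupp.linearCombination_single, one_smul, Finsupp.filter_apply]

/-- `Kh_h` depends on the orientations only through the gradings. -/
theorem nonempty_Kh_equiv_of_gradings_eq {o o' : D.LinkOrientation} {τ τ' : D.SourceSink}
    (h : o.homGrading = o'.homGrading) (q : o.quantumGrading = o'.quantumGrading)
    (t : τ.homotopicalGrading = τ'.homotopicalGrading) (i j : ℤ) (𝔥 : HGroup S) :
    Nonempty (D.Kh o τ i j 𝔥 ≃ₗ[ZMod 2] D.Kh o' τ' i j 𝔥) := by
  have hd : τ.diffH = τ'.diffH := by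
    classical
    ext x y
    simp only [LinearMap.comp_apply, Finsupp.lsingle_apply, SourceSink.diffH_single_apply]
    exact if_congr (by rw [t]) rfl rfl
  have hg : ∀ i, D.gradedPart o τ i j 𝔥 = D.gradedPart o' τ' i j 𝔥 := fun i => by
    simp only [gradedPart, h, q, t]
  unfold Kh boundaries cycles
  rw [hd, hg i, hg (i - 1)]
  exact ⟨LinearEquiv.refl _ _⟩

/-! ### Reversal of the link orientation. -/

theorem LinkOrientation.positive_reverse (o : D.LinkOrientation) (c : Fin D.n) :
    o.reverse.Positive c ↔ o.Positive c := by
  have key : ∀ o : D.LinkOrientation, o.Positive c → o.reverse.Positive c := by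
    rintro o ⟨k, hk, h0, h1⟩
    -- After reversal the opposite dart of the same overcrossing strand is the outgoing one.
    refine ⟨k + 2, ?_, ?_, ?_⟩
    · rw [IsOver] at hk ⊢
      rw [← hk]
      fin_cases k <;> decide
    · rw [o.reverse.straight]
      exact fun h => (outgoing_reverse D o.dir c k).1 h h0
    · rw [add_right_comm, o.reverse.straight]
      exact fun h => (outgoing_reverse D o.dir c (k + 1)).1 h h1
  have hrr : o.reverse.reverse = o := by
    cases o
    simp [LinkOrientation.reverse]
  exact ⟨fun h => hrr ▸ key _ h, key o⟩

theorem nonempty_Kh_reverse_equiv (o : D.LinkOrientation) (τ : D.SourceSink) (i j : ℤ)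
    (𝔥 : HGroup S) : Nonempty (D.Kh o.reverse τ i j 𝔥 ≃ₗ[ZMod 2] D.Kh o τ i j 𝔥) := by
  refine nonempty_Kh_equiv_of_gradings_eq ?_ ?_ rfl i j 𝔥 <;> funext x <;>
    simp only [LinkOrientation.homGrading, LinkOrientation.quantumGrading, LinkOrientation.nPos,
      LinkOrientation.nNeg, LinkOrientation.positive_reverse]

end LinkDiagram

end HomotopicalKhovanov

end

noncomputable section

namespace HomotopicalKhovanov
namespace LinkDiagram

variable {S : Type*} [TopologicalSpace S] [ChartedSpace ℂ S] {D : LinkDiagram S}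

/-! ### The differential and the gradings -/

open Classical in
theorem diff_single_apply (x y : D.EnhState) :
    D.diff (Finsupp.single x 1) y = ∑ c, if D.PartialTerm c x y then 1 else 0 := by
  rw [diff, LinearMap.sum_apply, Finsupp.finsetSum_apply]
  refine Finset.sum_congr rfl fun c _ => ?_
  rw [partialDiff, Finsupp.linearCombination_single, one_smul, Finsupp.finsetSum_apply]
  simp only [Finsupp.single_apply]
  rw [Finset.sum_ite_eq']
  simp

theorem exists_partialTerm {x y : D.EnhState} (h : D.diff (Finsupp.single x 1) y ≠ 0) :
    ∃ c, D.PartialTerm c x y := by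
  classical
  rw [diff_single_apply] at h
  obtain ⟨c, -, hc⟩ := Finset.exists_ne_zero_of_sum_ne_zero h
  exact ⟨c, by simpa using hc⟩

theorem resolution_subset {s s' : D.State} {c : Fin D.n} (h : ∀ c', c' ≠ c → s c' = s' c') :
    D.resolution s ⊆ D.resolution s' ∪ D.disc c := by
  rintro p (hp | hp)
  · exact Or.inl (Or.inl hp)
  · obtain ⟨⟨q, hq⟩, hpq⟩ := Set.mem_iUnion.1 hp
    by_cases hc : q.1 = c
    · exact Or.inr (hc ▸ smoothingArc_subset_disc _ _ hpq)
    · exact Or.inl (Or.inr (Set.mem_iUnion.2 ⟨⟨q, by rw [← h _ hc]; exact hq⟩, hpq⟩))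

/-- A circle away from the crossing `c` is not affected by a change of the resolution of `c`. -/
theorem mem_circles_of_not_meets [T2Space S] {s s' : D.State} {c : Fin D.n}
    (h : ∀ c', c' ≠ c → s c' = s' c') {C : Set S} (hC : C ∈ D.circles s) (hm : ¬ D.Meets c C) :
    C ∈ D.circles s' := by
  obtain ⟨p, hp, rfl⟩ := hC
  obtain ⟨hp', heq⟩ := connectedComponentIn_eq_of_disjoint (isClosed_resolution s)
    (isCompact_disc c).isClosed (D.finite_circles s) (resolution_subset h)
    (resolution_subset fun c' hc' => (h c' hc').symm) hp (not_not.1 hm)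
  exact ⟨p, hp', heq⟩

/-- Like `Δ`, the map `m` has degree `-1`; in the quantum grading this cancels the increase of
`β(s)`. -/
theorem MulTerm.sum_eq {a b c : ℤˣ} (h : MulTerm a b c) : (c : ℤ) = a + b - 1 := by
  rcases h with ⟨rfl, rfl, rfl⟩ | ⟨rfl, rfl, rfl⟩ | ⟨rfl, rfl, rfl⟩ <;> rfl

theorem ComulTerm.sum_eq {a b c : ℤˣ} (h : ComulTerm a b c) : (b + c : ℤ) = a - 1 := by
  rcases h with ⟨rfl, rfl, rfl⟩ | ⟨rfl, rfl, rfl⟩ | ⟨rfl, rfl, rfl⟩ <;> rfl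

theorem PartialTerm.eq_of_ne {c : Fin D.n} {x y : D.EnhState} (h : D.PartialTerm c x y)
    (c' : Fin D.n) (hc : c' ≠ c) : x.1 c' = y.1 c' := by
  rw [h.2.1, Function.update_of_ne hc]

open Classical in
-- The circles away from `c` are common to both resolutions and keep their labels; on those through
-- `c` the map is `m` or `Δ`.
theorem PartialTerm.sum_eq [T2Space S] {c : Fin D.n} {x y : D.EnhState}
    (h : D.PartialTerm c x y) : ∑ C, (y.2 C : ℤ) = ∑ C, (x.2 C : ℤ) - 1 := by
  have away : ∑ C ∈ Finset.univ.filter fun C : D.circles x.1 => ¬ D.Meets c C, (x.2 C : ℤ) =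
      ∑ C ∈ Finset.univ.filter fun C : D.circles y.1 => ¬ D.Meets c C, (y.2 C : ℤ) := by
    refine Finset.sum_bij'
      (fun C hC => ⟨C.1, mem_circles_of_not_meets h.eq_of_ne C.2 (Finset.mem_filter.1 hC).2⟩)
      (fun C hC => ⟨C.1, mem_circles_of_not_meets (fun c' hc' => (h.eq_of_ne c' hc').symm) C.2
        (Finset.mem_filter.1 hC).2⟩) ?_ ?_ ?_ ?_ ?_
    · intro C hC
      simpa using hC
    · intro C hC
      simpa using hC
    · intro C hC
      rfl
    · intro C hC
      rfl
    · intro C hC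
      rw [h.2.2.1 C.1 C.2 (mem_circles_of_not_meets h.eq_of_ne C.2 (Finset.mem_filter.1 hC).2)
        (Finset.mem_filter.1 hC).2]
  have near : ∑ C ∈ Finset.univ.filter fun C : D.circles y.1 => D.Meets c C, (y.2 C : ℤ) =
      ∑ C ∈ Finset.univ.filter fun C : D.circles x.1 => D.Meets c C, (x.2 C : ℤ) - 1 := by
    rcases h.2.2.2 with ⟨a, b, g, hab, hx, hy, ht⟩ | ⟨g, a, b, hab, hx, hy, ht⟩
    · simp only [hx, hy, Finset.filter_or, Finset.filter_eq', Finset.mem_univ, if_true,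
        Finset.sum_singleton]
      rw [Finset.sum_union (by simpa using hab), Finset.sum_singleton, Finset.sum_singleton]
      exact MulTerm.sum_eq ht
    · simp only [hx, hy, Finset.filter_or, Finset.filter_eq', Finset.mem_univ, if_true,
        Finset.sum_singleton]
      rw [Finset.sum_union (by simpa using hab), Finset.sum_singleton, Finset.sum_singleton]
      exact ComulTerm.sum_eq ht
  rw [← Finset.sum_filter_add_sum_filter_not Finset.univ fun C : D.circles y.1 =>
      D.Meets c (C : Set S),
    ← Finset.sum_filter_add_sum_filter_not Finset.univ
      (fun C : D.circles x.1 => D.Meets c (C : Set S))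
      (fun C => (x.2 C : ℤ)), near, away]
  ring

theorem PartialTerm.ncard_eq {c : Fin D.n} {x y : D.EnhState} (h : D.PartialTerm c x y) :
    {c | y.1 c = true}.ncard = {c | x.1 c = true}.ncard + 1 := by
  have : {c | y.1 c = true} = insert c {c | x.1 c = true} := by
    ext c'
    rw [h.2.1]
    by_cases hc : c' = c <;> simp [Function.update_apply, hc]
  rw [this, Set.ncard_insert_of_notMem (by simp [h.1])]

/-- The differential `d_h` has degree `1` in the homological grading and preserves the other
gradings. -/
theorem SourceSink.grading_of_diffH_ne_zero [T2Space S] (τ : D.SourceSink)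
    (o : D.LinkOrientation) {x y : D.EnhState} (h : τ.diffH (Finsupp.single x 1) y ≠ 0) :
    o.homGrading y = o.homGrading x + 1 ∧ o.quantumGrading y = o.quantumGrading x ∧
      τ.homotopicalGrading y = τ.homotopicalGrading x := by
  classical
  rw [SourceSink.diffH_single_apply] at h
  split_ifs at h with hh
  · obtain ⟨c, hc⟩ := exists_partialTerm h
    refine ⟨?_, ?_, hh⟩
    · simp only [LinkOrientation.homGrading, hc.ncard_eq]
      push_cast
      ring
    · simp only [LinkOrientation.quantumGrading, hc.ncard_eq, hc.sum_eq]
      push_cast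
      ring
  · exact absurd rfl h

end LinkDiagram
end HomotopicalKhovanov

end

noncomputable section

namespace HomotopicalKhovanov
namespace LinkDiagram

variable {S : Type*} [TopologicalSpace S] [ChartedSpace ℂ S] {D : LinkDiagram S}

/-! ### The mirror image -/

variable (D) in
theorem isOver_mirror (c : Fin D.n) (k : Fin 4) : D.mirror.IsOver c k ↔ ¬ D.IsOver c k := by
  change (Even (k : ℕ) ↔ (!(D.realOver c)) = true) ↔ ¬ (Even (k : ℕ) ↔ D.realOver c = true)
  cases D.realOver c <;> simp

/-- Strands pass straight through, so darts `0` and `1` determine the sign. In this form exchanging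
over and under visibly negates the condition. -/
theorem LinkOrientation.positive_iff (o : D.LinkOrientation) (c : Fin D.n) :
    o.Positive c ↔ (D.realOver c = true ↔ (o.dir.Outgoing c 0 ↔ o.dir.Outgoing c 1)) := by
  have h2 : o.dir.Outgoing c 2 ↔ ¬ o.dir.Outgoing c 0 := o.straight c 0
  have h3 : o.dir.Outgoing c 3 ↔ ¬ o.dir.Outgoing c 1 := o.straight c 1
  have e : o.Positive c ↔ (D.IsOver c 0 ∧ o.dir.Outgoing c 0 ∧ o.dir.Outgoing c 1) ∨
      (D.IsOver c 1 ∧ o.dir.Outgoing c 1 ∧ o.dir.Outgoing c 2) ∨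
      (D.IsOver c 2 ∧ o.dir.Outgoing c 2 ∧ o.dir.Outgoing c 3) ∨
      (D.IsOver c 3 ∧ o.dir.Outgoing c 3 ∧ o.dir.Outgoing c 0) := by
    constructor
    · rintro ⟨k, hk⟩
      fin_cases k
      · exact Or.inl hk
      · exact Or.inr (Or.inl hk)
      · exact Or.inr (Or.inr (Or.inl hk))
      · exact Or.inr (Or.inr (Or.inr hk))
    · rintro (h | h | h | h)
      exacts [⟨0, h⟩, ⟨1, h⟩, ⟨2, h⟩, ⟨3, h⟩]
  have i0 : D.IsOver c 0 ↔ D.realOver c = true := by simp [IsOver]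
  have i1 : D.IsOver c 1 ↔ ¬ D.realOver c = true := by simp [IsOver]
  have i2 : D.IsOver c 2 ↔ D.realOver c = true := by simp [IsOver]
  have i3 : D.IsOver c 3 ↔ ¬ D.realOver c = true := by
    have : ¬ Even 3 := by decide
    simp [IsOver, this]
  rw [e, i0, i1, i2, i3, h2, h3]
  generalize o.dir.Outgoing c 0 = a
  generalize o.dir.Outgoing c 1 = b
  by_cases ha : a <;> by_cases hb : b <;> simp [ha, hb]

theorem LinkOrientation.positive_mirror (o : D.LinkOrientation) (c : Fin D.n) :
    o.mirror.Positive c ↔ ¬ o.Positive c := by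
  refine (LinkOrientation.positive_iff (D := D.mirror) o.mirror c).trans
    (Iff.trans ?_ (not_congr (o.positive_iff c)).symm)
  change ((!(D.realOver c)) = true ↔ (o.dir.Outgoing c 0 ↔ o.dir.Outgoing c 1)) ↔ _
  cases D.realOver c <;> simp

theorem LinkOrientation.nPos_mirror (o : D.LinkOrientation) : o.mirror.nPos = o.nNeg := by
  have : {c | o.mirror.Positive c} = {c | ¬ o.Positive c} := Set.ext o.positive_mirror
  exact congrArg Set.ncard this

theorem LinkOrientation.nNeg_mirror (o : D.LinkOrientation) : o.mirror.nNeg = o.nPos := by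
  have : {c | ¬ o.mirror.Positive c} = {c | o.Positive c} :=
    Set.ext fun c => (not_congr (o.positive_mirror c)).trans not_not
  exact congrArg Set.ncard this

theorem LinkOrientation.nPos_add_nNeg (o : D.LinkOrientation) : o.nPos + o.nNeg = D.n := by
  have := Set.ncard_add_ncard_compl {c | o.Positive c}
  rwa [Nat.card_eq_fintype_card, Fintype.card_fin] at this

/-- The state with the opposite resolution at each crossing. -/
def State.compl (s : D.State) : D.State := fun c => !(s c)

theorem State.compl_compl (s : D.State) : s.compl.compl = s := by
  funext c
  simp [State.compl]

theorem State.ncard_compl (s : D.State) :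
    {c | s.compl c = true}.ncard + {c | s c = true}.ncard = D.n := by
  have h : {c | s.compl c = true} = {c | s c = true}ᶜ := by
    ext c
    simp [State.compl]
  have := Set.ncard_add_ncard_compl {c | s c = true}
  rw [Nat.card_eq_fintype_card, Fintype.card_fin] at this
  rw [h]
  omega

/-- Both sides of the equivalence that selects the smoothing arcs are negated, so the same arcs are
selected. -/
theorem resolution_mirror (s : D.State) : D.mirror.resolution s.compl = D.resolution s := by
  have key : ∀ q : Fin D.n × Fin 4, (D.mirror.IsOver q.1 q.2 ↔ s.compl q.1 = true) ↔
      (D.IsOver q.1 q.2 ↔ s q.1 = true) := by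
    intro q
    rw [isOver_mirror, State.compl]
    cases s q.1 <;> simp
  refine congrArg (fun A => (⋃ e : D.Edge, Set.range (D.edge e)) ∪ A) ?_
  ext p
  simp only [Set.mem_iUnion]
  constructor
  · rintro ⟨⟨q, hq⟩, hp⟩
    exact ⟨⟨q, (key q).1 hq⟩, hp⟩
  · rintro ⟨⟨q, hq⟩, hp⟩
    exact ⟨⟨q, (key q).2 hq⟩, hp⟩

theorem circles_mirror (s : D.State) : D.mirror.circles s.compl = D.circles s := by
  change (fun p => connectedComponentIn (D.mirror.resolution s.compl) p) ''
    D.mirror.resolution s.compl = _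
  rw [resolution_mirror]
  rfl

theorem circles_mirror' (s : D.State) : D.circles s.compl = D.mirror.circles s := by
  rw [← circles_mirror s.compl, State.compl_compl]

/-- Labels are compared on the underlying subsets of `S`, which avoids transport along the equality
of states. -/
theorem enhState_ext {x y : D.EnhState} (h : x.1 = y.1)
    (h' : ∀ C hx hy, x.2 ⟨C, hx⟩ = y.2 ⟨C, hy⟩) : x = y := by
  obtain ⟨s, ε⟩ := x
  obtain ⟨s', ε'⟩ := y
  obtain rfl : s = s' := h
  congr 1
  funext C
  exact h' C.1 C.2 C.2

variable (D) in
/-- The correspondence between the basis vectors of the complexes of a diagram and of its mirror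
image, which exchanges the resolutions, and also `v₊` and `v₋`. -/
def mirrorEquiv : D.EnhState ≃ D.mirror.EnhState where
  toFun x := ⟨State.compl (D := D) x.1, fun C => -x.2 ⟨C.1, circles_mirror x.1 ▸ C.2⟩⟩
  invFun x := ⟨State.compl (D := D) x.1, fun C => -x.2 ⟨C.1, circles_mirror' (D := D) x.1 ▸ C.2⟩⟩
  left_inv x := enhState_ext (State.compl_compl x.1) fun _ _ _ => neg_neg _
  right_inv x := enhState_ext (D := D.mirror) (State.compl_compl (D := D) x.1)
    fun _ _ _ => neg_neg _

/-- The circles of a resolution of the mirror image. -/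
def mirrorCircle (x : D.EnhState) : D.circles x.1 ≃ D.mirror.circles (D.mirrorEquiv x).1 :=
  Equiv.setCongr (circles_mirror x.1).symm

theorem mirrorEquiv_snd (x : D.EnhState) (C : D.circles x.1) :
    (D.mirrorEquiv x).2 (mirrorCircle x C) = -x.2 C := rfl

/-- Duality of the Frobenius algebra `V`: under the pairing in which `v₊` and `v₋` are dual to each
other, `m` and `Δ` are transposes. -/
theorem mulTerm_neg_iff (a b c : ℤˣ) : MulTerm (-a) (-b) (-c) ↔ ComulTerm c a b := by
  rcases Int.units_eq_one_or a with rfl | rfl <;> rcases Int.units_eq_one_or b with rfl | rfl <;>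
    rcases Int.units_eq_one_or c with rfl | rfl <;> simp [MulTerm, ComulTerm]

theorem comulTerm_neg_iff (a b c : ℤˣ) : ComulTerm (-a) (-b) (-c) ↔ MulTerm b c a := by
  rw [← mulTerm_neg_iff]
  simp only [neg_neg]

theorem mergeTerm_mirror_iff (c : Fin D.n) (x y : D.EnhState) :
    D.mirror.MergeTerm c (D.mirrorEquiv x) (D.mirrorEquiv y) ↔ D.SplitTerm c y x := by
  constructor
  · rintro ⟨a, b, g, hab, hx, hy, ht⟩
    obtain ⟨a, rfl⟩ := (mirrorCircle x).surjective a
    obtain ⟨b, rfl⟩ := (mirrorCircle x).surjective b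
    obtain ⟨g, rfl⟩ := (mirrorCircle y).surjective g
    rw [mirrorEquiv_snd, mirrorEquiv_snd, mirrorEquiv_snd, mulTerm_neg_iff] at ht
    refine ⟨g, a, b, fun h => hab (h ▸ rfl), fun C => ?_, fun C => ?_, ht⟩
    · exact (hy (mirrorCircle y C)).trans (mirrorCircle y).apply_eq_iff_eq
    · exact (hx (mirrorCircle x C)).trans
        (or_congr (mirrorCircle x).apply_eq_iff_eq (mirrorCircle x).apply_eq_iff_eq)
  · rintro ⟨g, a, b, hab, hy, hx, ht⟩
    refine ⟨mirrorCircle x a, mirrorCircle x b, mirrorCircle y g,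
      fun h => hab ((mirrorCircle x).injective h), fun C => ?_, fun C => ?_, ?_⟩
    · obtain ⟨C, rfl⟩ := (mirrorCircle x).surjective C
      rw [(mirrorCircle x).apply_eq_iff_eq, (mirrorCircle x).apply_eq_iff_eq]
      exact hx C
    · obtain ⟨C, rfl⟩ := (mirrorCircle y).surjective C
      rw [(mirrorCircle y).apply_eq_iff_eq]
      exact hy C
    · rwa [mirrorEquiv_snd, mirrorEquiv_snd, mirrorEquiv_snd, mulTerm_neg_iff]

theorem splitTerm_mirror_iff (c : Fin D.n) (x y : D.EnhState) :
    D.mirror.SplitTerm c (D.mirrorEquiv x) (D.mirrorEquiv y) ↔ D.MergeTerm c y x := by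
  constructor
  · rintro ⟨g, a, b, hab, hx, hy, ht⟩
    obtain ⟨a, rfl⟩ := (mirrorCircle y).surjective a
    obtain ⟨b, rfl⟩ := (mirrorCircle y).surjective b
    obtain ⟨g, rfl⟩ := (mirrorCircle x).surjective g
    rw [mirrorEquiv_snd, mirrorEquiv_snd, mirrorEquiv_snd, comulTerm_neg_iff] at ht
    refine ⟨a, b, g, fun h => hab (h ▸ rfl), fun C => ?_, fun C => ?_, ht⟩
    · exact (hy (mirrorCircle y C)).trans
        (or_congr (mirrorCircle y).apply_eq_iff_eq (mirrorCircle y).apply_eq_iff_eq)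
    · exact (hx (mirrorCircle x C)).trans (mirrorCircle x).apply_eq_iff_eq
  · rintro ⟨a, b, g, hab, hy, hx, ht⟩
    refine ⟨mirrorCircle x g, mirrorCircle y a, mirrorCircle y b,
      fun h => hab ((mirrorCircle y).injective h), fun C => ?_, fun C => ?_, ?_⟩
    · obtain ⟨C, rfl⟩ := (mirrorCircle x).surjective C
      rw [(mirrorCircle x).apply_eq_iff_eq]
      exact hx C
    · obtain ⟨C, rfl⟩ := (mirrorCircle y).surjective C
      rw [(mirrorCircle y).apply_eq_iff_eq, (mirrorCircle y).apply_eq_iff_eq]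
      exact hy C
    · rwa [mirrorEquiv_snd, mirrorEquiv_snd, mirrorEquiv_snd, comulTerm_neg_iff]

/-- Complementation reverses the edges of the state cube. -/
theorem State.compl_eq_update_iff (s s' : D.State) (c : Fin D.n) :
    (s.compl c = false ∧ s'.compl = Function.update s.compl c true) ↔
      (s' c = false ∧ s = Function.update s' c true) := by
  simp only [funext_iff, Function.update_apply, State.compl]
  constructor
  · rintro ⟨h, h'⟩
    have := h' c
    refine ⟨by simpa using this, fun a => ?_⟩
    have := h' a
    split_ifs at this ⊢ with hac
    · subst hac
      simpa using h
    · simpa using this.symm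
  · rintro ⟨h, h'⟩
    have := h' c
    refine ⟨by simpa using this, fun a => ?_⟩
    have := h' a
    split_ifs at this ⊢ with hac
    · subst hac
      simpa using h
    · simpa using this.symm

theorem partialTerm_mirror_iff (c : Fin D.n) (x y : D.EnhState) :
    D.mirror.PartialTerm c (D.mirrorEquiv x) (D.mirrorEquiv y) ↔ D.PartialTerm c y x := by
  have h1 := State.compl_eq_update_iff x.1 y.1 c
  have h2 : (∀ (C : Set S) (hx : C ∈ D.mirror.circles (D.mirrorEquiv x).1)
      (hy : C ∈ D.mirror.circles (D.mirrorEquiv y).1), ¬ D.mirror.Meets c C →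
        (D.mirrorEquiv x).2 ⟨C, hx⟩ = (D.mirrorEquiv y).2 ⟨C, hy⟩) ↔
      (∀ (C : Set S) (hy : C ∈ D.circles y.1) (hx : C ∈ D.circles x.1), ¬ D.Meets c C →
        y.2 ⟨C, hy⟩ = x.2 ⟨C, hx⟩) := by
    constructor
    · intro h C hy hx hm
      exact (neg_injective (h C (circles_mirror x.1 ▸ hx) (circles_mirror y.1 ▸ hy) hm)).symm
    · intro h C hx hy hm
      exact congrArg Neg.neg (h C (circles_mirror y.1 ▸ hy) (circles_mirror x.1 ▸ hx) hm).symm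
  have h3 := mergeTerm_mirror_iff c x y
  have h4 := splitTerm_mirror_iff c x y
  constructor
  · rintro ⟨ha, hb, hc, hd⟩
    exact ⟨(h1.1 ⟨ha, hb⟩).1, (h1.1 ⟨ha, hb⟩).2, h2.1 hc, (hd.imp h3.1 h4.1).symm⟩
  · rintro ⟨ha, hb, hc, hd⟩
    exact ⟨(h1.2 ⟨ha, hb⟩).1, (h1.2 ⟨ha, hb⟩).2, h2.2 hc, (hd.imp h4.2 h3.2).symm⟩

theorem sum_mirrorEquiv {M : Type*} [AddCommMonoid M] (x : D.EnhState) (f : ℤˣ → Set S → M) :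
    ∑ C, f ((D.mirrorEquiv x).2 C) C = ∑ C, f (-x.2 C) C :=
  (Equiv.sum_comp (mirrorCircle x) fun C => f ((D.mirrorEquiv x).2 C) C).symm

/-- The mirror degree is `(n - β) - n₊`, and `n = n₊ + n₋`. -/
theorem LinkOrientation.homGrading_mirror (o : D.LinkOrientation) (x : D.EnhState) :
    o.mirror.homGrading (D.mirrorEquiv x) = -o.homGrading x := by
  rw [LinkOrientation.homGrading, LinkOrientation.homGrading, LinkOrientation.nNeg_mirror]
  have h1 : ({c | (D.mirrorEquiv x).1 c = true}.ncard : ℤ) + {c | x.1 c = true}.ncard = D.n := by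
    exact_mod_cast State.ncard_compl x.1
  have h2 : (o.nPos : ℤ) + o.nNeg = D.n := by exact_mod_cast o.nPos_add_nNeg
  linarith

theorem LinkOrientation.quantumGrading_mirror (o : D.LinkOrientation) (x : D.EnhState) :
    o.mirror.quantumGrading (D.mirrorEquiv x) = -o.quantumGrading x := by
  rw [LinkOrientation.quantumGrading, LinkOrientation.quantumGrading, LinkOrientation.nNeg_mirror,
    LinkOrientation.nPos_mirror, sum_mirrorEquiv x fun a _ => (a : ℤ)]
  have h1 : ({c | (D.mirrorEquiv x).1 c = true}.ncard : ℤ) + {c | x.1 c = true}.ncard = D.n := by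
    exact_mod_cast State.ncard_compl x.1
  have h2 : (o.nPos : ℤ) + o.nNeg = D.n := by exact_mod_cast o.nPos_add_nNeg
  simp only [Units.val_neg, Finset.sum_neg_distrib]
  linarith

theorem SourceSink.homotopicalGrading_mirror (τ : D.SourceSink) (x : D.EnhState) :
    τ.mirror.homotopicalGrading (D.mirrorEquiv x) = -τ.homotopicalGrading x := by
  rw [SourceSink.homotopicalGrading, SourceSink.homotopicalGrading,
    sum_mirrorEquiv x fun a C => (a : ℤ) • τ.mirror.circleClass C, ← Finset.sum_neg_distrib]
  refine Finset.sum_congr rfl fun C _ => ?_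
  rw [Units.val_neg, neg_smul]
  -- The mirror image has the same edges with the same directions, so its `circleClass` is that of
  -- `D` by definition.
  rfl

/-- The full differentials are transposes by `partialTerm_mirror_iff`. Restricting to `d_h` respects
this, since equality of homotopical gradings is symmetric and survives the change of sign. -/
theorem SourceSink.isTransposeAlong_diffH (τ : D.SourceSink) :
    haveI : Fact (Nat.Prime 2) := ⟨Nat.prime_two⟩
    IsTransposeAlong (K := ZMod 2) D.mirrorEquiv τ.diffH τ.mirror.diffH := by
  classical
  have : Fact (Nat.Prime 2) := ⟨Nat.prime_two⟩
  refine isTransposeAlong_iff.2 fun x y => ?_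
  have h1 := τ.mirror.diffH_single_apply (D.mirrorEquiv x) (D.mirrorEquiv y)
  have h2 := τ.diffH_single_apply y x
  have h3 : D.mirror.diff (Finsupp.single (D.mirrorEquiv x) 1) (D.mirrorEquiv y) =
      D.diff (Finsupp.single y 1) x := by
    rw [diff_single_apply, diff_single_apply]
    exact Finset.sum_congr rfl fun c _ => if_congr (partialTerm_mirror_iff (D := D) c x y) rfl rfl
  refine h1.trans (Eq.trans (if_congr ?_ h3 rfl) h2.symm)
  rw [τ.homotopicalGrading_mirror, τ.homotopicalGrading_mirror, neg_inj, eq_comm]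

theorem nonempty_Kh_mirror_equiv [T2Space S] (o : D.LinkOrientation) (τ : D.SourceSink) (i j : ℤ)
    (𝔥 : HGroup S) :
    Nonempty (D.mirror.Kh o.mirror τ.mirror i j 𝔥 ≃ₗ[ZMod 2] D.Kh o τ (-i) (-j) (-𝔥)) := by
  have : Fact (Nat.Prime 2) := ⟨Nat.prime_two⟩
  -- Only the dimensions are compared. Degree `i - 1` of the mirror image corresponds to degree `-i
  -- + 1` of `D`, which is the set `P₂`.
  refine FiniteDimensional.nonempty_linearEquiv_of_finrank_eq ?_
  refine finrank_homology_transpose (K := ZMod 2) D.mirrorEquiv τ.isTransposeAlong_diffH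
    (P₂ := {x | o.homGrading x = -i + 1 ∧ o.quantumGrading x = -j ∧
      τ.homotopicalGrading x = -𝔥}) ?_ ?_ ?_ ?_
  · intro x y h
    obtain ⟨h1, h2, h3⟩ := τ.grading_of_diffH_ne_zero o h
    simp only [Set.mem_ofPred_eq, h1, h2, h3, eq_sub_iff_add_eq]
  · intro x y h
    obtain ⟨h1, h2, h3⟩ := τ.grading_of_diffH_ne_zero o h
    simp only [Set.mem_ofPred_eq, h1, h2, h3, add_left_inj]
  · intro x
    simp only [Set.mem_ofPred_eq, o.homGrading_mirror, o.quantumGrading_mirror,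
      τ.homotopicalGrading_mirror, neg_eq_iff_eq_neg, neg_sub, neg_add_eq_sub]
  · intro x
    simp only [Set.mem_ofPred_eq, o.homGrading_mirror, o.quantumGrading_mirror,
      τ.homotopicalGrading_mirror, neg_eq_iff_eq_neg]

end LinkDiagram
end HomotopicalKhovanov

end

theorem mainTheorem5 {S : Type*} [TopologicalSpace S] [T2Space S] [CompactSpace S]
    [ConnectedSpace S] [ChartedSpace ℂ S] [HomotopicalKhovanov.OrientedSurface S]
    (D : HomotopicalKhovanov.LinkDiagram S) (o : D.LinkOrientation) (τ : D.SourceSink) :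
    (∀ (i j : ℤ) (h : HomotopicalKhovanov.HGroup S),
      Nonempty (D.Kh o.reverse τ i j h ≃ₗ[ZMod 2] D.Kh o τ i j h)) ∧
    (∀ (i j : ℤ) (h : HomotopicalKhovanov.HGroup S),
      Nonempty (D.mirror.Kh o.mirror τ.mirror i j h ≃ₗ[ZMod 2] D.Kh o τ (-i) (-j) (-h))) ∧
    (∀ (i j : ℤ) (h : HomotopicalKhovanov.HGroup S),
      Nonempty (D.Kh o τ.reverse i j h ≃ₗ[ZMod 2] D.Kh o τ i j h)) ∧
    (∀ (τ' : D.SourceSink) (i j : ℤ) (h : HomotopicalKhovanov.HGroup S),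
      Nonempty (D.Kh o τ' i j h ≃ₗ[ZMod 2] D.Kh o τ i j h)) := by
  refine ⟨fun i j h => HomotopicalKhovanov.LinkDiagram.nonempty_Kh_reverse_equiv o τ i j h,
    fun i j h => HomotopicalKhovanov.LinkDiagram.nonempty_Kh_mirror_equiv o τ i j h,
    fun i j h => ?_, fun τ' i j h => ?_⟩ <;>
  exact HomotopicalKhovanov.LinkDiagram.nonempty_Kh_equiv_of_gradings_eq rfl rfl
    (HomotopicalKhovanov.LinkDiagram.SourceSink.homotopicalGrading_eq _ _) i j h
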